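/- Let $q$ be a complex number with $0<|q|<1$. Write $$(a;q)_n=\prod_{j=0}^{n-1}(1-aq^j),\qquad (a_1,a_2;q)_n=(a_1;q)_n(a_2;q)_n,\qquad \psi(q)=\sum_{n=0}^{\infty}q^{n(n+1)/2}.$$ Then each of the four series below converges absolutely, and $$\begin{aligned} 2q\,\psi(q^2)\,\psi(q^6)={}&\sum_{n=1}^{\infty}\frac{1+q^{12n-1}}{1+1/q}\,\frac{(-1/q,-1/q;q^6)_n\,(q^6;q^6)_{2n-1}\,(-q)^{5n}}{(q^6,q^6;q^6)_n\,(q^4;q^6)_{2n}}\\ &-\sum_{n=1}^{\infty}\frac{1-q^{12n-1}}{1-1/q}\,\frac{(1/q,1/q;q^6)_n\,(q^6;q^6)_{2n-1}\,q^{5n}}{(q^6,q^6;q^6)_n\,(q^4;q^6)_{2n}}\\ &+\sum_{n=1}^{\infty}\frac{1-q^{12n-5}}{1-1/q^5}\,\frac{(1/q^5,1/q^5;q^6)_n\,(q^6;q^6)_{2n-1}\,q^{n}}{(q^6,q^6;q^6)_n\,(1/q^4;q^6)_{2n}}\\ &-\sum_{n=1}^{\infty}\frac{1+q^{12n-5}}{1+1/q^5}\,\frac{(-1/q^5,-1/q^5;q^6)_n\,(q^6;q^6)_{2n-1}\,(-q)^{n}}{(q^6,q^6;q^6)_n\,(1/q^4;q^6)_{2n}}.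 \end{aligned}$$ -/

import Mathlib

/-- The finite `q`-shifted factorial `(a; q)_n = (1 - a)(1 - a q) ⋯ (1 - a q^(n-1))`. -/
noncomputable def qPoch (a q : ℂ) (n : ℕ) : ℂ :=
  ∏ j ∈ Finset.range n, (1 - a * q ^ j)

/-- The theta function `ψ(q) = ∑_{n ≥ 0} q^(n(n+1)/2)`, absolutely convergent for `|q| < 1`
(the exponent `n(n+1)/2` is an exact division). -/
noncomputable def ramanujanPsi (q : ℂ) : ℂ :=
  ∑' n : ℕ, q ^ (n * (n + 1) / 2)

/-!
Write `Λ(b)` for the very-well-poised series with parameter `b` and `L(b)` for the Lambert series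
`∑_{k ≥ 1} b q^k / (1 - b q^k)`, over a fixed base `q`. A Wilf–Zeilberger certificate shows that
the second difference of `Λ` along `b ↦ b q` is rational and equal to that of `L(b) - L(b²)`; both
functions tend to `0` along `b q^m`, hence `Λ(b) = L(b) - L(b²)`. Since the second term is even in
`b`, the four series of the theorem, which have base `q⁶` and `b = ±1/q, ±1/q⁵`, combine to the odd
parts of `L` at `1/q⁵` and `1/q`.

The difference of those odd parts is a bilateral Lambert series, which a specialization of the
`₆φ₅` summation formula evaluates as an infinite product; that formula follows by iterating a
contiguous relation `(a, z) ↦ (a q, z q)`. The product is identified with `2 q ψ(q²) ψ(q⁶)` by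
Gauss's formula `ψ(q) = (q²; q²)_∞ / (q; q²)_∞`, the limit of an exact formula for its partial sums.
-/

open Filter Topology Asymptotics

section General

theorem isBigO_top_comp {α β E F : Type*} [Norm E] [Norm F] {u : α → E} {v : α → F}
    (h : u =O[⊤] v) (k : β → α) :
    (fun x => u (k x)) =O[⊤] fun x => v (k x) :=
  h.comp_tendsto tendsto_top

variable {E : Type*} [NormedAddCommGroup E]

theorem eq_sub_of_hasSum_sub_succ {f A : ℕ → E} {S L : E} (hf : HasSum f S)
    (hA : Tendsto A atTop (𝓝 L)) (h : ∀ n, f n = A n - A (n + 1)) : S = A 0 - L := by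
  refine tendsto_nhds_unique hf.tendsto_sum_nat ((hA.const_sub (A 0)).congr fun n => ?_)
  rw [Finset.sum_congr rfl fun k _ => h k, Finset.sum_range_sub']

theorem eq_zero_of_second_difference_eq_zero {u : ℕ → E} (hu : Tendsto u atTop (𝓝 0))
    (h : ∀ m, u m - u (m + 1) = u (m + 1) - u (m + 2)) (m : ℕ) : u m = 0 := by
  have hu' := hu.comp (tendsto_add_atTop_nat 1)
  have hdiff : ∀ m, u m - u (m + 1) = u 0 - u 1 := fun m => by
    induction m with
    | zero => rfl
    | succ m ih => rw [← h, ih]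
  have hzero : u 0 - u 1 = 0 :=
    tendsto_nhds_unique (tendsto_const_nhds.congr fun m => (hdiff m).symm)
      (by simpa using hu.sub hu')
  have hconst : ∀ m, u m = u 0 := fun m => by
    induction m with
    | zero => rfl
    | succ m ih => rw [← ih, ← sub_eq_zero.1 ((hdiff m).trans hzero)]
  rw [hconst m]
  exact tendsto_nhds_unique (tendsto_const_nhds.congr fun m => (hconst m).symm) hu

theorem isBigO_top_one_of_tendsto {u : ℕ → E} {L : E} (h : Tendsto u atTop (𝓝 L)) :
    u =O[⊤] fun _ => (1 : ℂ) :=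
  (h.isBigO_one ℂ).nat_of_atTop (by simp)

variable {f : ℕ → ℕ → E} {r s : ℂ}

theorem summable_of_isBigO_mul_pow [CompleteSpace E] (hs : ‖s‖ < 1)
    (h : (fun p : ℕ × ℕ => f p.1 p.2) =O[⊤] fun p => r ^ p.1 * s ^ p.2) (m : ℕ) :
    Summable (f m) := by
  have hm := (isBigO_top_comp h fun n => (m, n)).mono (le_top : atTop ≤ ⊤)
  exact summable_of_isBigO_nat ((summable_norm_geometric_of_norm_lt_one hs).mul_left ‖r ^ m‖)
    (by simpa using hm.norm_right)

theorem tendsto_tsum_of_isBigO_mul_pow (hr : ‖r‖ < 1) (hs : ‖s‖ < 1)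
    (h : (fun p : ℕ × ℕ => f p.1 p.2) =O[⊤] fun p => r ^ p.1 * s ^ p.2) :
    Tendsto (fun m => ∑' n, f m n) atTop (𝓝 0) := by
  obtain ⟨K, hK⟩ := h.bound
  simp only [eventually_top, norm_mul, norm_pow, Prod.forall] at hK
  have hgeom := (hasSum_geometric_of_lt_one (norm_nonneg s) hs)
  refine squeeze_zero_norm
    (fun m => tsum_of_norm_bounded ((hgeom.mul_left _).mul_left K) (hK m)) ?_
  simpa using ((tendsto_pow_atTop_nhds_zero_of_lt_one (norm_nonneg r) hr).mul_const
    (1 - ‖s‖)⁻¹).const_mul K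

end General

section QPochhammer

variable {a q : ℂ}

theorem one_sub_ne_zero_of_norm_lt_one (ha : ‖a‖ < 1) : 1 - a ≠ 0 := by
  rw [sub_ne_zero]
  rintro rfl
  simp at ha

theorem norm_pow_lt_one (hq : ‖q‖ < 1) {k : ℕ} (hk : k ≠ 0) : ‖q ^ k‖ < 1 := by
  rw [norm_pow]
  exact pow_lt_one₀ (norm_nonneg q) hq hk

theorem norm_mul_pow_lt_one (hq : ‖q‖ < 1) (ha : ‖a‖ < 1) (j : ℕ) : ‖a * q ^ j‖ < 1 := by
  rw [norm_mul, norm_pow]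
  exact (mul_le_of_le_one_right (norm_nonneg a) (pow_le_one₀ (norm_nonneg q) hq.le)).trans_lt ha

theorem one_sub_mul_pow_ne_zero (hq : ‖q‖ < 1) (ha : ‖a‖ < 1) (j : ℕ) : 1 - a * q ^ j ≠ 0 :=
  one_sub_ne_zero_of_norm_lt_one (norm_mul_pow_lt_one hq ha j)

theorem one_sub_mul_pow_ne_zero_of_ne_one (hq : ‖q‖ < 1) (ha : a ≠ 1) (haq : ‖a * q‖ < 1) :
    ∀ j : ℕ, 1 - a * q ^ j ≠ 0
  | 0 => by simpa [sub_eq_zero] using ha.symm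
  | j + 1 => by
    rw [pow_succ', ← mul_assoc]
    exact one_sub_mul_pow_ne_zero hq haq j

theorem qPoch_one (a q : ℂ) : qPoch a q 1 = 1 - a := by
  simp [qPoch]

theorem qPoch_succ (a q : ℂ) (n : ℕ) : qPoch a q (n + 1) = qPoch a q n * (1 - a * q ^ n) :=
  Finset.prod_range_succ _ n

theorem qPoch_add (a q : ℂ) (m n : ℕ) :
    qPoch a q (m + n) = qPoch a q m * qPoch (a * q ^ m) q n := by
  simp only [qPoch, Finset.prod_range_add, pow_add, mul_assoc]

theorem qPoch_ne_zero (h : ∀ j : ℕ, 1 - a * q ^ j ≠ 0) (n : ℕ) : qPoch a q n ≠ 0 :=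
  Finset.prod_ne_zero_iff.2 fun j _ => h j

theorem qPoch_mul_base (ha : 1 - a ≠ 0) (n : ℕ) :
    qPoch (a * q) q n = qPoch a q n * ((1 - a * q ^ n) / (1 - a)) := by
  have h := qPoch_add a q 1 n
  rw [add_comm, qPoch_succ, pow_one, qPoch_one] at h
  rw [← mul_div_assoc, h, mul_div_cancel_left₀ _ ha]

theorem qPoch_mul (a q : ℂ) (k n : ℕ) :
    qPoch a q (k * n) = ∏ i ∈ Finset.range k, qPoch (a * q ^ i) (q ^ k) n := by
  induction n with
  | zero => simp [qPoch]
  | succ n ih =>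
    simp only [qPoch_succ, Finset.prod_mul_distrib, ← ih]
    rw [Nat.mul_succ, qPoch_add, qPoch]
    refine congrArg _ (Finset.prod_congr rfl fun i _ => ?_)
    ring

/-- The infinite `q`-shifted factorial `(a; q)_∞`, convergent for `|q| < 1`. -/
noncomputable def qPochInf (a q : ℂ) : ℂ :=
  ∏' j : ℕ, (1 - a * q ^ j)

theorem summable_norm_neg_mul_pow (hq : ‖q‖ < 1) (a : ℂ) :
    Summable fun j : ℕ => ‖-(a * q ^ j)‖ := by
  simpa using (summable_norm_geometric_of_norm_lt_one hq).mul_left ‖a‖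

theorem tendsto_qPoch (hq : ‖q‖ < 1) (a : ℂ) :
    Tendsto (qPoch a q) atTop (𝓝 (qPochInf a q)) := by
  simpa only [qPoch, qPochInf, sub_eq_add_neg] using!
    (multipliable_one_add_of_summable (summable_norm_neg_mul_pow hq a)).hasProd.tendsto_prod_nat

theorem qPochInf_ne_zero (hq : ‖q‖ < 1) (h : ∀ j : ℕ, 1 - a * q ^ j ≠ 0) : qPochInf a q ≠ 0 := by
  simpa only [qPochInf, sub_eq_add_neg] using
    tprod_one_add_ne_zero_of_summable (f := fun j : ℕ => -(a * q ^ j))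
      (fun j => by simpa only [sub_eq_add_neg] using h j) (summable_norm_neg_mul_pow hq a)

theorem qPochInf_mul_base (hq : ‖q‖ < 1) (ha : 1 - a ≠ 0) :
    qPochInf (a * q) q = qPochInf a q / (1 - a) := by
  refine tendsto_nhds_unique (tendsto_qPoch hq (a * q)) ?_
  have hpow := ((tendsto_pow_atTop_nhds_zero_of_norm_lt_one hq).const_mul a).const_sub 1
  simpa [funext (qPoch_mul_base ha), div_eq_mul_inv] using
    (tendsto_qPoch hq a).mul (hpow.div_const (1 - a))

theorem qPochInf_eq_prod (hq : ‖q‖ < 1) (a : ℂ) {k : ℕ} (hk : k ≠ 0) :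
    qPochInf a q = ∏ i ∈ Finset.range k, qPochInf (a * q ^ i) (q ^ k) := by
  have hprod := tendsto_finsetProd (Finset.range k) fun i _ =>
    tendsto_qPoch (norm_pow_lt_one hq hk) (a * q ^ i)
  exact tendsto_nhds_unique
    ((tendsto_qPoch hq a).comp (tendsto_id.const_mul_atTop' (Nat.pos_of_ne_zero hk)))
    (hprod.congr fun n => (qPoch_mul a q k n).symm)

theorem isBigO_one_sub_mul_pow (hq : ‖q‖ < 1) (a : ℂ) :
    (fun n : ℕ => 1 - a * q ^ n) =O[⊤] fun _ => (1 : ℂ) :=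
  isBigO_top_one_of_tendsto
    (((tendsto_pow_atTop_nhds_zero_of_norm_lt_one hq).const_mul a).const_sub 1)

theorem isBigO_qPoch (hq : ‖q‖ < 1) (a : ℂ) : qPoch a q =O[⊤] fun _ => (1 : ℂ) :=
  isBigO_top_one_of_tendsto (tendsto_qPoch hq a)

theorem isBigO_inv_qPoch (hq : ‖q‖ < 1) (h : ∀ j : ℕ, 1 - a * q ^ j ≠ 0) :
    (fun n => (qPoch a q n)⁻¹) =O[⊤] fun _ => (1 : ℂ) :=
  isBigO_top_one_of_tendsto ((tendsto_qPoch hq a).inv₀ (qPochInf_ne_zero hq h))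

theorem qPoch_mul_pow_eq_div (h : ∀ j : ℕ, 1 - a * q ^ j ≠ 0) (m n : ℕ) :
    qPoch (a * q ^ m) q n = qPoch a q (m + n) * (qPoch a q m)⁻¹ := by
  rw [qPoch_add, mul_comm (qPoch a q m), mul_inv_cancel_right₀ (qPoch_ne_zero h m)]

theorem isBigO_qPoch_mul_pow (hq : ‖q‖ < 1) (h : ∀ j : ℕ, 1 - a * q ^ j ≠ 0) :
    (fun p : ℕ × ℕ => qPoch (a * q ^ p.1) q p.2) =O[⊤] fun _ => (1 : ℂ) := by
  simpa [qPoch_mul_pow_eq_div h] using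
    (isBigO_top_comp (isBigO_qPoch hq a) fun p : ℕ × ℕ => p.1 + p.2).mul
      (isBigO_top_comp (isBigO_inv_qPoch hq h) Prod.fst)

theorem isBigO_inv_qPoch_mul_pow (hq : ‖q‖ < 1) (h : ∀ j : ℕ, 1 - a * q ^ j ≠ 0) :
    (fun p : ℕ × ℕ => (qPoch (a * q ^ p.1) q p.2)⁻¹) =O[⊤] fun _ => (1 : ℂ) := by
  simpa [qPoch_mul_pow_eq_div h] using
    (isBigO_top_comp (isBigO_qPoch hq a) Prod.fst).mul
      (isBigO_top_comp (isBigO_inv_qPoch hq h) fun p : ℕ × ℕ => p.1 + p.2)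

theorem isBigO_mul_pow_pow_succ (hq : ‖q‖ < 1) (z : ℂ) :
    (fun p : ℕ × ℕ => (z * q ^ p.1) ^ (p.2 + 1)) =O[⊤] fun p => q ^ p.1 * z ^ p.2 := by
  refine IsBigO.of_bound ‖z‖ (Eventually.of_forall fun ⟨m, n⟩ => ?_)
  have hqmn : ‖q ^ (m * n)‖ ≤ 1 := by
    rw [norm_pow]
    exact pow_le_one₀ (norm_nonneg q) hq.le
  calc ‖(z * q ^ m) ^ (n + 1)‖ = ‖z‖ * ‖q ^ m * z ^ n‖ * ‖q ^ (m * n)‖ := by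
        simp only [← norm_mul]
        ring_nf
    _ ≤ ‖z‖ * ‖q ^ m * z ^ n‖ := mul_le_of_le_one_right (by positivity) hqmn

end QPochhammer

section Lambert

variable {a q : ℂ}

/-- The Lambert series `∑_{k ≥ 1} a q^k / (1 - a q^k)`, convergent for `|q| < 1`. -/
noncomputable def lambertSum (a q : ℂ) : ℂ :=
  ∑' k : ℕ, a * q ^ (k + 1) / (1 - a * q ^ (k + 1))

theorem summable_lambert (hq : ‖q‖ < 1) (a : ℂ) :
    Summable fun k : ℕ => a * q ^ (k + 1) / (1 - a * q ^ (k + 1)) := by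
  have hpow : Tendsto (fun k : ℕ => a * q ^ (k + 1)) atTop (𝓝 0) := by
    simpa using ((tendsto_pow_atTop_nhds_zero_of_norm_lt_one hq).comp
      (tendsto_add_atTop_nat 1)).const_mul a
  have hinv : Tendsto (fun k : ℕ => (1 - a * q ^ (k + 1))⁻¹) atTop (𝓝 1) := by
    simpa using (hpow.const_sub 1).inv₀ (by simp)
  have hsum : Summable fun k : ℕ => ‖a * q ^ (k + 1)‖ :=
    (summable_nat_add_iff (f := fun k : ℕ => ‖a * q ^ k‖) 1).2
      (by simpa only [norm_neg] using summable_norm_neg_mul_pow hq a)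
  refine summable_of_isBigO_nat hsum ?_
  have h := (isBigO_refl (fun k : ℕ => a * q ^ (k + 1)) atTop).mul (hinv.isBigO_one ℂ)
  simpa only [div_eq_mul_inv, mul_one] using h.norm_right

theorem lambertSum_eq_add (hq : ‖q‖ < 1) (a : ℂ) :
    lambertSum a q = a * q / (1 - a * q) + lambertSum (a * q) q := by
  rw [lambertSum, (summable_lambert hq a).tsum_eq_zero_add, lambertSum]
  simp only [zero_add, pow_one, pow_succ' q (_ + 1), mul_assoc]

theorem tendsto_lambertSum (a q : ℂ) :
    Tendsto (fun m : ℕ => lambertSum (a * q ^ m) q) atTop (𝓝 0) := by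
  refine (tendsto_sum_nat_add
    fun k : ℕ => a * q ^ (k + 1) / (1 - a * q ^ (k + 1))).congr fun m => ?_
  simp only [lambertSum, mul_assoc, ← pow_add, add_comm, add_assoc]

theorem hasSum_lambertSum_sub_neg (hq : ‖q‖ < 1) (ha : ‖a * q‖ < 1) :
    HasSum (fun k : ℕ => 2 * (a * q ^ (k + 1) / (1 - (a * q ^ (k + 1)) ^ 2)))
      (lambertSum a q - lambertSum (-a) q) := by
  refine ((summable_lambert hq a).hasSum.sub (summable_lambert hq (-a)).hasSum).congr_fun ?_
  intro k
  have hnorm : ‖a * q ^ (k + 1)‖ < 1 := by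
    rw [pow_succ', ← mul_assoc]
    exact norm_mul_pow_lt_one hq ha k
  have hsub := one_sub_ne_zero_of_norm_lt_one hnorm
  have hadd : 1 + a * q ^ (k + 1) ≠ 0 := by
    simpa using one_sub_ne_zero_of_norm_lt_one (a := -(a * q ^ (k + 1))) (by simpa using hnorm)
  rw [show 1 - (a * q ^ (k + 1)) ^ 2 = (1 - a * q ^ (k + 1)) * (1 + a * q ^ (k + 1)) by ring,
    neg_mul, sub_neg_eq_add]
  field_simp
  ring

end Lambert

section VeryWellPoised

variable {b q : ℂ}

/-- The `n`-th term, `n ≥ 1`, of the very-well-poised series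
`∑ (1 - b q^(2n)) / (1 - b) · (b, b; q)_n (q; q)_(2n-1) (b q)^n / ((q, q; q)_n (b² q; q)_(2n))`. -/
noncomputable def vwpTerm (b q : ℂ) (n : ℕ) : ℂ :=
  (1 - b * q ^ (2 * n)) / (1 - b) *
    (qPoch b q n * qPoch b q n * qPoch q q (2 * n - 1) * (b * q) ^ n /
      (qPoch q q n * qPoch q q n * qPoch (b ^ 2 * q) q (2 * n)))

/-- The `q`-hypergeometric part common to `vwpTerm b q (n + 1)` and its shifts `b ↦ b q`,
`n ↦ n + 1`: the quotients are rational functions of `b`, `q` and `q ^ (n + 1)`. -/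
noncomputable def vwpKernel (b q : ℂ) (n : ℕ) : ℂ :=
  qPoch b q (n + 1) ^ 2 * qPoch q q (2 * n + 1) * (b * q) ^ (n + 1) /
    (qPoch q q n ^ 2 * qPoch (b ^ 2 * q) q (2 * n + 2))

/-- The ratio of `vwpKernel (b * q) q n` to `vwpKernel b q n`, where `x = q ^ (n + 1)`. -/
noncomputable def vwpBaseRatio (b q x : ℂ) : ℂ :=
  ((1 - b * x) / (1 - b)) ^ 2 * x * ((1 - b ^ 2 * q) * (1 - b ^ 2 * q ^ 2)) /
    ((1 - b ^ 2 * q * x ^ 2) * (1 - b ^ 2 * q ^ 2 * x ^ 2))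

/-- The numerator of `vwpCertificate`. Its coefficients were found by solving the linear system
that comes from comparing powers of `x` in `vwpCertPoly_identity`. -/
noncomputable def vwpCertPoly (b q x : ℂ) : ℂ :=
  (1 - b) * (1 + b ^ 6 * q ^ 4 * x ^ 4) - 2 * b * (1 - b ^ 2 * q) * (x + b ^ 3 * q ^ 3 * x ^ 3) +
    (b ^ 2 + b ^ 3 * (1 - b) * (q + q ^ 2 + q ^ 3) - b ^ 5 * q ^ 4) * x ^ 2

/-- The Wilf–Zeilberger certificate for the second difference of `vwpTerm` in the direction
`b ↦ b q`, as a multiple of `vwpKernel`, where `x = q ^ (n + 1)`. -/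
noncomputable def vwpCertificate (b q x : ℂ) : ℂ :=
  vwpCertPoly b q x /
    ((1 - b) ^ 2 * (1 - b * q) * ((1 - b ^ 2 * q * x ^ 2) * (1 - b ^ 2 * q ^ 2 * x ^ 2)))

theorem vwpTerm_succ (b q : ℂ) (n : ℕ) :
    vwpTerm b q (n + 1) =
      vwpKernel b q n * ((1 - b * (q ^ (n + 1)) ^ 2) / ((1 - b) * (1 - q ^ (n + 1)) ^ 2)) := by
  rw [vwpTerm, vwpKernel, show 2 * (n + 1) - 1 = 2 * n + 1 by omega, mul_add_one, qPoch_succ q q n,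
    ← pow_succ']
  simp only [div_eq_mul_inv, mul_inv, mul_pow, ← inv_pow]
  ring

theorem vwpKernel_mul_base (hb : 1 - b ≠ 0) (hb₁ : 1 - b ^ 2 * q ≠ 0) (hb₂ : 1 - b ^ 2 * q ^ 2 ≠ 0)
    (n : ℕ) :
    vwpKernel (b * q) q n = vwpKernel b q n * vwpBaseRatio b q (q ^ (n + 1)) := by
  have hden : qPoch ((b * q) ^ 2 * q) q (2 * n + 2) = qPoch (b ^ 2 * q) q (2 * n + 2) *
      ((1 - b ^ 2 * q * (q ^ (n + 1)) ^ 2) * (1 - b ^ 2 * q ^ 2 * (q ^ (n + 1)) ^ 2) /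
        ((1 - b ^ 2 * q) * (1 - b ^ 2 * q ^ 2))) := by
    rw [show (b * q) ^ 2 * q = b ^ 2 * q * q * q by ring,
      qPoch_mul_base (by rwa [mul_assoc, ← pow_two]), qPoch_mul_base hb₁]
    simp only [div_eq_mul_inv, mul_inv]
    ring
  rw [vwpKernel, hden, qPoch_mul_base hb, vwpKernel, vwpBaseRatio]
  simp only [div_eq_mul_inv, mul_inv, inv_inv, mul_pow]
  ring

theorem vwpKernel_succ (b q : ℂ) (n : ℕ) :
    vwpKernel b q (n + 1) = vwpKernel b q n *
      ((1 - b * q ^ (n + 1)) ^ 2 * (1 - (q ^ (n + 1)) ^ 2) * (1 - q * (q ^ (n + 1)) ^ 2) * (b * q) /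
        ((1 - q ^ (n + 1)) ^ 2 *
          ((1 - b ^ 2 * q * (q ^ (n + 1)) ^ 2) * (1 - b ^ 2 * q ^ 2 * (q ^ (n + 1)) ^ 2)))) := by
  simp only [vwpKernel, show 2 * (n + 1) + 1 = 2 * n + 1 + 1 + 1 by omega,
    show 2 * (n + 1) + 2 = 2 * n + 2 + 1 + 1 by omega, qPoch_succ _ _ (n + 1), qPoch_succ q q n,
    qPoch_succ _ _ (2 * n + 1 + 1), qPoch_succ q q (2 * n + 1), qPoch_succ _ _ (2 * n + 2 + 1),
    div_eq_mul_inv, mul_inv, mul_pow]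
  ring

theorem vwpCertPoly_identity (b q x : ℂ) :
    (1 - b) * (1 - b * q) * ((1 - b ^ 2 * q * x ^ 2) * (1 - b ^ 2 * q ^ 2 * x ^ 2)) *
          ((1 - b ^ 2 * q ^ 3 * x ^ 2) * (1 - b ^ 2 * q ^ 4 * x ^ 2)) * (1 - b * x ^ 2) -
        2 * ((1 - b * q) * ((1 - b ^ 2 * q ^ 3 * x ^ 2) * (1 - b ^ 2 * q ^ 4 * x ^ 2)) *
          ((1 - b * x) ^ 2 * x * (1 - b ^ 2 * q) * (1 + b * q) * (1 - b * q * x ^ 2))) +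
        (1 - b * x) ^ 2 * (1 - b * q * x) ^ 2 * x ^ 2 * (1 - b ^ 2 * q) * (1 - b ^ 2 * q ^ 3) *
          (1 + b * q) * (1 + b * q ^ 2) * (1 - b * q ^ 2 * x ^ 2) =
      vwpCertPoly b q x * ((1 - b ^ 2 * q ^ 3 * x ^ 2) * (1 - b ^ 2 * q ^ 4 * x ^ 2)) *
          (1 - x) ^ 2 -
        (1 - b * x) ^ 2 * (1 - x ^ 2) * (1 - q * x ^ 2) * (b * q) * vwpCertPoly b q (x * q) := by
  rw [vwpCertPoly, vwpCertPoly]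
  ring

theorem vwpCertificate_identity {x : ℂ} (hx : 1 - x ≠ 0) (hb₀ : 1 - b ≠ 0) (hb₁ : 1 - b * q ≠ 0)
    (hb₂ : 1 - b * q ^ 2 ≠ 0) (hu₁ : 1 - b ^ 2 * q * x ^ 2 ≠ 0)
    (hu₂ : 1 - b ^ 2 * q ^ 2 * x ^ 2 ≠ 0) (hu₃ : 1 - b ^ 2 * q ^ 3 * x ^ 2 ≠ 0)
    (hu₄ : 1 - b ^ 2 * q ^ 4 * x ^ 2 ≠ 0) :
    (1 - b * x ^ 2) / ((1 - b) * (1 - x) ^ 2) -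
        2 * (vwpBaseRatio b q x * ((1 - b * q * x ^ 2) / ((1 - b * q) * (1 - x) ^ 2))) +
        vwpBaseRatio b q x * vwpBaseRatio (b * q) q x *
          ((1 - b * q ^ 2 * x ^ 2) / ((1 - b * q ^ 2) * (1 - x) ^ 2)) =
      vwpCertificate b q x - (1 - b * x) ^ 2 * (1 - x ^ 2) * (1 - q * x ^ 2) * (b * q) /
        ((1 - x) ^ 2 * ((1 - b ^ 2 * q * x ^ 2) * (1 - b ^ 2 * q ^ 2 * x ^ 2))) *
          vwpCertificate b q (x * q) := by
  have hr : vwpBaseRatio (b * q) q x = ((1 - b * q * x) / (1 - b * q)) ^ 2 * x *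
      ((1 - b ^ 2 * q ^ 3) * ((1 - b * q ^ 2) * (1 + b * q ^ 2))) /
        ((1 - b ^ 2 * q ^ 3 * x ^ 2) * (1 - b ^ 2 * q ^ 4 * x ^ 2)) := by
    rw [vwpBaseRatio]
    ring
  have hc : vwpCertificate b q (x * q) = vwpCertPoly b q (x * q) / ((1 - b) ^ 2 * (1 - b * q) *
      ((1 - b ^ 2 * q ^ 3 * x ^ 2) * (1 - b ^ 2 * q ^ 4 * x ^ 2))) := by
    rw [vwpCertificate]
    ring
  have hpoly := vwpCertPoly_identity b q x
  rw [hr, hc, vwpBaseRatio, vwpCertificate,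
    show 1 - b ^ 2 * q ^ 2 = (1 - b * q) * (1 + b * q) by ring]
  -- `hpoly` is the only relation needed, so the denominators may be treated as free variables.
  generalize 1 - b ^ 2 * q * x ^ 2 = u₁ at *
  generalize 1 - b ^ 2 * q ^ 2 * x ^ 2 = u₂ at *
  generalize 1 - b ^ 2 * q ^ 3 * x ^ 2 = u₃ at *
  generalize 1 - b ^ 2 * q ^ 4 * x ^ 2 = u₄ at *
  generalize 1 - b = d₀ at *
  generalize 1 - b * q = d₁ at *
  generalize 1 - b * q ^ 2 = d₂ at *
  generalize 1 - x = y at *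
  field_simp
  linear_combination hpoly

theorem vwpTerm_second_difference (hq : ‖q‖ < 1) (hb : ∀ j : ℕ, 1 - b * q ^ j ≠ 0)
    (hb₂ : ∀ j : ℕ, 1 - b ^ 2 * q * q ^ j ≠ 0) (n : ℕ) :
    vwpTerm b q (n + 1) - 2 * vwpTerm (b * q) q (n + 1) + vwpTerm (b * q ^ 2) q (n + 1) =
      vwpCertificate b q (q ^ (n + 1)) * vwpKernel b q n -
        vwpCertificate b q (q ^ (n + 2)) * vwpKernel b q (n + 1) := by
  have hv (i : ℕ) : 1 - b ^ 2 * q ^ (i + 1) ≠ 0 := by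
    simpa only [pow_succ', mul_assoc] using hb₂ i
  have hu (i : ℕ) : 1 - b ^ 2 * q ^ (i + 1) * (q ^ (n + 1)) ^ 2 ≠ 0 := by
    rw [mul_assoc, ← pow_mul, ← pow_add, show i + 1 + (n + 1) * 2 = i + 2 * n + 2 + 1 by ring]
    exact hv _
  have hx : 1 - q ^ (n + 1) ≠ 0 := by
    simpa only [pow_succ'] using one_sub_mul_pow_ne_zero hq hq n
  have hb₀ : 1 - b ≠ 0 := by simpa using hb 0
  have hb₁ : 1 - b * q ≠ 0 := by simpa using hb 1
  have hbase := vwpKernel_mul_base hb₀ (by simpa using hv 0) (hv 1) n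
  have hbase' := vwpKernel_mul_base (q := q) hb₁ (by convert hv 2 using 1; ring)
    (by convert hv 3 using 1; ring) n
  have hcert := vwpCertificate_identity hx hb₀ hb₁ (hb 2) (by simpa using hu 0) (hu 1) (hu 2) (hu 3)
  rw [show b * q ^ 2 = b * q * q by ring] at hcert ⊢
  rw [vwpTerm_succ, vwpTerm_succ, vwpTerm_succ, hbase', hbase, vwpKernel_succ, pow_succ q (n + 1)]
  linear_combination vwpKernel b q n * hcert

theorem tendsto_vwpKernel (hq : ‖q‖ < 1) (hbq : ‖b * q‖ < 1)
    (hb₂ : ∀ j : ℕ, 1 - b ^ 2 * q * q ^ j ≠ 0) : Tendsto (vwpKernel b q) atTop (𝓝 0) := by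
  have hodd : Tendsto (fun n : ℕ => 2 * n + 1) atTop atTop :=
    tendsto_atTop_mono (fun n => (by omega : n ≤ 2 * n + 1)) tendsto_id
  have hnum := ((((tendsto_qPoch hq b).comp (tendsto_add_atTop_nat 1)).pow 2).mul
    ((tendsto_qPoch hq q).comp hodd)).mul
      ((tendsto_pow_atTop_nhds_zero_of_norm_lt_one hbq).comp (tendsto_add_atTop_nat 1))
  have hden := ((tendsto_qPoch hq q).pow 2).mul ((tendsto_qPoch hq (b ^ 2 * q)).comp
    ((tendsto_add_atTop_nat 1).comp hodd))
  have hne := mul_ne_zero (pow_ne_zero 2 (qPochInf_ne_zero hq (one_sub_mul_pow_ne_zero hq hq)))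
    (qPochInf_ne_zero hq hb₂)
  simpa [vwpKernel, Function.comp_def] using! hnum.div hden hne

theorem tendsto_vwpCertificate (hq : ‖q‖ < 1) (b : ℂ) :
    Tendsto (fun n : ℕ => vwpCertificate b q (q ^ (n + 1))) atTop (𝓝 (vwpCertificate b q 0)) := by
  by_cases hb : (1 - b) ^ 2 * (1 - b * q) = 0
  · simp [vwpCertificate, hb]
  · have hcont : ContinuousAt (vwpCertificate b q) 0 := by
      refine ContinuousAt.div (by unfold vwpCertPoly; fun_prop) (by fun_prop) ?_
      simpa using hb
    exact hcont.tendsto.comp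
      ((tendsto_pow_atTop_nhds_zero_of_norm_lt_one hq).comp (tendsto_add_atTop_nat 1))

theorem vwpCertificate_mul_vwpKernel_zero (hq : ‖q‖ < 1) (hb : ∀ j : ℕ, 1 - b * q ^ j ≠ 0)
    (hb₂ : ∀ j : ℕ, 1 - b ^ 2 * q * q ^ j ≠ 0) :
    vwpCertificate b q q * vwpKernel b q 0 =
      lambertSum b q - lambertSum (b ^ 2) q -
        2 * (lambertSum (b * q) q - lambertSum ((b * q) ^ 2) q) +
        (lambertSum (b * q ^ 2) q - lambertSum ((b * q ^ 2) ^ 2) q) := by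
  have hb₀ : 1 - b ≠ 0 := by simpa using hb 0
  have hb₁ : 1 - b * q ≠ 0 := by simpa using hb 1
  have hb₃ := hb 2
  have hv (i : ℕ) : 1 - b ^ 2 * q ^ (i + 1) ≠ 0 := by
    simpa only [pow_succ', mul_assoc] using hb₂ i
  have hv₁ : 1 - b ^ 2 * q ≠ 0 := by simpa using hv 0
  have hv₂ : 1 - b ^ 2 * q ^ 2 ≠ 0 := hv 1
  have hv₃ : 1 - b ^ 2 * q ^ 3 ≠ 0 := hv 2
  have hv₄ : 1 - b ^ 2 * q ^ 4 ≠ 0 := hv 3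
  have hrat : vwpCertificate b q q * vwpKernel b q 0 =
      b * q / (1 - b * q) - b * q ^ 2 / (1 - b * q ^ 2) -
        (b ^ 2 * q / (1 - b ^ 2 * q) + b ^ 2 * q ^ 2 / (1 - b ^ 2 * q ^ 2) -
          b ^ 2 * q ^ 3 / (1 - b ^ 2 * q ^ 3) - b ^ 2 * q ^ 4 / (1 - b ^ 2 * q ^ 4)) := by
    simp only [vwpCertificate, vwpCertPoly, vwpKernel, qPoch, Finset.prod_range_succ,
      Finset.range_zero, Finset.prod_empty, mul_zero, zero_add, pow_zero, pow_one, one_pow, mul_one,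
      one_mul]
    field_simp
    ring
  rw [show (b * q) ^ 2 = b ^ 2 * q * q by ring, show b * q ^ 2 = b * q * q by ring,
    show (b * q * q) ^ 2 = b ^ 2 * q * q * q * q by ring, lambertSum_eq_add hq b,
    lambertSum_eq_add hq (b * q), lambertSum_eq_add hq (b ^ 2), lambertSum_eq_add hq (b ^ 2 * q),
    lambertSum_eq_add hq (b ^ 2 * q * q), lambertSum_eq_add hq (b ^ 2 * q * q * q)]
  linear_combination hrat

theorem isBigO_vwpTerm_mul_pow_succ (hq : ‖q‖ < 1) (hb : ∀ j : ℕ, 1 - b * q ^ j ≠ 0)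
    (hb₂ : ∀ j : ℕ, 1 - b ^ 2 * q * q ^ j ≠ 0) :
    (fun p : ℕ × ℕ => vwpTerm (b * q ^ p.1) q (p.2 + 1)) =O[⊤]
      fun p => q ^ p.1 * (b * q) ^ p.2 := by
  have hlin := isBigO_top_comp (isBigO_one_sub_mul_pow hq b)
    fun p : ℕ × ℕ => p.1 + 2 * (p.2 + 1)
  have hbase := isBigO_top_comp (isBigO_inv_qPoch_mul_pow hq hb) fun p : ℕ × ℕ => (p.1, 1)
  have hnum := isBigO_top_comp (isBigO_qPoch_mul_pow hq hb) fun p : ℕ × ℕ => (p.1, p.2 + 1)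
  have hodd := isBigO_top_comp (isBigO_qPoch hq q) fun p : ℕ × ℕ => 2 * p.2 + 1
  have hden := isBigO_top_comp (isBigO_inv_qPoch hq (one_sub_mul_pow_ne_zero hq hq))
    fun p : ℕ × ℕ => p.2 + 1
  have hsq := isBigO_top_comp (isBigO_inv_qPoch_mul_pow hq hb₂)
    fun p : ℕ × ℕ => (2 * p.1, 2 * (p.2 + 1))
  have h := (((((hlin.mul hbase).mul (hnum.pow 2)).mul hodd).mul (hden.pow 2)).mul hsq).mul
    (isBigO_mul_pow_pow_succ hq (b * q))
  refine h.congr (fun ⟨m, n⟩ => ?_) fun _ => by simp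
  rw [vwpTerm, show 2 * (n + 1) - 1 = 2 * n + 1 by omega,
    show (b * q ^ m) ^ 2 * q = b ^ 2 * q * q ^ (2 * m) by ring]
  simp only [qPoch_one, pow_add, div_eq_mul_inv, mul_inv]
  ring

theorem summable_vwpTerm_mul_pow (hq : ‖q‖ < 1) (hbq : ‖b * q‖ < 1)
    (hb : ∀ j : ℕ, 1 - b * q ^ j ≠ 0) (hb₂ : ∀ j : ℕ, 1 - b ^ 2 * q * q ^ j ≠ 0) (m : ℕ) :
    Summable fun n : ℕ => vwpTerm (b * q ^ m) q (n + 1) :=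
  summable_of_isBigO_mul_pow (f := fun m n => vwpTerm (b * q ^ m) q (n + 1)) hbq
    (isBigO_vwpTerm_mul_pow_succ hq hb hb₂) m

theorem tsum_vwpTerm_second_difference (hq : ‖q‖ < 1) (hbq : ‖b * q‖ < 1)
    (hb : ∀ j : ℕ, 1 - b * q ^ j ≠ 0) (hb₂ : ∀ j : ℕ, 1 - b ^ 2 * q * q ^ j ≠ 0) :
    ∑' n : ℕ, vwpTerm b q (n + 1) - 2 * ∑' n : ℕ, vwpTerm (b * q) q (n + 1) +
        ∑' n : ℕ, vwpTerm (b * q ^ 2) q (n + 1) =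
      lambertSum b q - lambertSum (b ^ 2) q -
        2 * (lambertSum (b * q) q - lambertSum ((b * q) ^ 2) q) +
        (lambertSum (b * q ^ 2) q - lambertSum ((b * q ^ 2) ^ 2) q) := by
  have hsum := summable_vwpTerm_mul_pow hq hbq hb hb₂
  have h₀ := (hsum 0).hasSum
  have h₁ := (hsum 1).hasSum
  simp only [pow_zero, pow_one, mul_one] at h₀ h₁
  have hlim :
      Tendsto (fun n => vwpCertificate b q (q ^ (n + 1)) * vwpKernel b q n) atTop (𝓝 0) := by
    simpa using (tendsto_vwpCertificate hq b).mul (tendsto_vwpKernel hq hbq hb₂)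
  have htele := eq_sub_of_hasSum_sub_succ ((h₀.sub (h₁.mul_left 2)).add (hsum 2).hasSum) hlim
    (vwpTerm_second_difference hq hb hb₂)
  rw [htele, sub_zero, zero_add, pow_one, vwpCertificate_mul_vwpKernel_zero hq hb hb₂]

theorem hasSum_vwpTerm (hq : ‖q‖ < 1) (hbq : ‖b * q‖ < 1) (hb : b ≠ 1) (hb₂ : b ^ 2 * q ≠ 1) :
    HasSum (fun n : ℕ => vwpTerm b q (n + 1)) (lambertSum b q - lambertSum (b ^ 2) q) := by
  have hb' := one_sub_mul_pow_ne_zero_of_ne_one hq hb hbq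
  have hb₂' := one_sub_mul_pow_ne_zero_of_ne_one hq hb₂ (by
    rw [mul_assoc, ← pow_two, ← mul_pow]
    exact norm_pow_lt_one hbq two_ne_zero)
  let defect : ℕ → ℂ := fun m => (∑' n, vwpTerm (b * q ^ m) q (n + 1)) -
    (lambertSum (b * q ^ m) q - lambertSum ((b * q ^ m) ^ 2) q)
  have hlim : Tendsto defect atTop (𝓝 0) := by
    have hsq : Tendsto (fun m : ℕ => lambertSum ((b * q ^ m) ^ 2) q) atTop (𝓝 0) :=
      ((tendsto_lambertSum (b ^ 2) q).comp (tendsto_id.const_mul_atTop' two_pos)).congr fun m => by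
        simp only [Function.comp_apply, id, mul_pow, ← pow_mul, mul_comm m 2]
    simpa using (tendsto_tsum_of_isBigO_mul_pow (f := fun m n => vwpTerm (b * q ^ m) q (n + 1))
      hq hbq (isBigO_vwpTerm_mul_pow_succ hq hb' hb₂')).sub ((tendsto_lambertSum b q).sub hsq)
  have hdiff (m : ℕ) : defect m - defect (m + 1) = defect (m + 1) - defect (m + 2) := by
    have hm := tsum_vwpTerm_second_difference (b := b * q ^ m) hq
      (by simpa only [mul_right_comm] using norm_mul_pow_lt_one hq hbq m)
      (fun j => by simpa only [mul_assoc, ← pow_add] using hb' (m + j))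
      (fun j => by convert hb₂' (2 * m + j) using 1; ring)
    simp only [mul_assoc, ← pow_succ, ← pow_add] at hm
    linear_combination hm
  have hzero : defect 0 = 0 := eq_zero_of_second_difference_eq_zero hlim hdiff 0
  have hsum := (summable_vwpTerm_mul_pow hq hbq hb' hb₂' 0).hasSum
  rwa [sub_eq_zero.1 hzero, pow_zero, mul_one] at hsum

end VeryWellPoised

section SixPhiFive

variable {a b c d q z : ℂ}

/-- The `q`-hypergeometric part of `sixPhiFiveTerm`. -/
noncomputable def sixPhiFiveKernel (a b c d q z : ℂ) (n : ℕ) : ℂ :=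
  qPoch a q n * qPoch b q n * qPoch c q n * qPoch d q n * z ^ n /
    (qPoch q q n * qPoch (z * c * d) q n * qPoch (z * b * d) q n * qPoch (z * b * c) q n)

/-- The `n`-th term of the very-well-poised `₆φ₅` series with parameters `a`, `b`, `c`, `d` and
argument `z`. The lower parameters `a q / b`, `a q / c`, `a q / d` are written `z c d`, `z b d`,
`z b c`, which is the same thing under the condition `a q = z b c d` that makes the series
summable in closed form. -/
noncomputable def sixPhiFiveTerm (a b c d q z : ℂ) (n : ℕ) : ℂ :=
  (1 - a * (q ^ n) ^ 2) / (1 - a) * sixPhiFiveKernel a b c d q z n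

theorem sixPhiFiveKernel_succ (a b c d q z : ℂ) (n : ℕ) :
    sixPhiFiveKernel a b c d q z (n + 1) = sixPhiFiveKernel a b c d q z n *
      ((1 - a * q ^ n) * (1 - b * q ^ n) * (1 - c * q ^ n) * (1 - d * q ^ n) * z /
        ((1 - q * q ^ n) * (1 - z * c * d * q ^ n) * (1 - z * b * d * q ^ n) *
          (1 - z * b * c * q ^ n))) := by
  simp only [sixPhiFiveKernel, qPoch_succ, div_eq_mul_inv, mul_inv]
  ring

theorem sixPhiFiveKernel_mul_base (ha : 1 - a ≠ 0) (hcd : 1 - z * c * d ≠ 0)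
    (hbd : 1 - z * b * d ≠ 0) (hbc : 1 - z * b * c ≠ 0) (n : ℕ) :
    sixPhiFiveKernel (a * q) b c d q (z * q) n = sixPhiFiveKernel a b c d q z n *
      ((1 - a * q ^ n) / (1 - a) * q ^ n *
        ((1 - z * c * d) * (1 - z * b * d) * (1 - z * b * c) /
          ((1 - z * c * d * q ^ n) * (1 - z * b * d * q ^ n) * (1 - z * b * c * q ^ n)))) := by
  rw [sixPhiFiveKernel, show z * q * c * d = z * c * d * q by ring,
    show z * q * b * d = z * b * d * q by ring, show z * q * b * c = z * b * c * q by ring,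
    qPoch_mul_base ha, qPoch_mul_base hcd, qPoch_mul_base hbd, qPoch_mul_base hbc, sixPhiFiveKernel]
  simp only [div_eq_mul_inv, mul_inv, inv_inv, mul_pow]
  ring

theorem sixPhiFive_polynomial_identity (h : a * q = z * b * c * d) (x : ℂ) :
    (1 - z) * (1 - a * x ^ 2) *
          ((1 - z * c * d * x) * (1 - z * b * d * x) * (1 - z * b * c * x)) -
        (1 - z * b) * (1 - z * c) * (1 - z * d) * (1 - a * q * x ^ 2) * (1 - a * x) * x =
      (1 - x) * (1 - a * z * x) *
          ((1 - z * c * d * x) * (1 - z * b * d * x) * (1 - z * b * c * x)) -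
        z * (1 - a * q * z * x) * (1 - a * x) * (1 - b * x) * (1 - c * x) * (1 - d * x) := by
  linear_combination (1 - a * x) * ((1 - z * b) * (1 - z * c) * (1 - z * d) * x ^ 3 -
    z ^ 2 * x * ((1 - b * x) * (1 - c * x) * (1 - d * x))) * h

/-- The antidifference in the contiguous relation between the `₆φ₅` series with parameters
`(a, z)` and `(a q, z q)`. -/
noncomputable def sixPhiFiveAntidiff (a b c d q z : ℂ) (n : ℕ) : ℂ :=
  (1 - z * c * d) * (1 - z * b * d) * (1 - z * b * c) / (1 - a) *
    ((1 - q ^ n) * (1 - a * z * q ^ n)) * sixPhiFiveKernel a b c d q z n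

theorem sixPhiFiveTerm_contiguous (hq : ‖q‖ < 1) (h : a * q = z * b * c * d)
    (ha : ∀ j : ℕ, 1 - a * q ^ j ≠ 0) (hcd : ∀ j : ℕ, 1 - z * c * d * q ^ j ≠ 0)
    (hbd : ∀ j : ℕ, 1 - z * b * d * q ^ j ≠ 0) (hbc : ∀ j : ℕ, 1 - z * b * c * q ^ j ≠ 0) (n : ℕ) :
    (1 - z) * ((1 - z * c * d) * (1 - z * b * d) * (1 - z * b * c)) *
          sixPhiFiveTerm a b c d q z n -
        (1 - a * q) * (1 - z * b) * (1 - z * c) * (1 - z * d) *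
          sixPhiFiveTerm (a * q) b c d q (z * q) n =
      sixPhiFiveAntidiff a b c d q z n - sixPhiFiveAntidiff a b c d q z (n + 1) := by
  have ha₀ : 1 - a ≠ 0 := by simpa using ha 0
  have ha₁ : 1 - a * q ≠ 0 := by simpa using ha 1
  have hqn := one_sub_mul_pow_ne_zero hq hq n
  have hcdn := hcd n
  have hbdn := hbd n
  have hbcn := hbc n
  rw [sixPhiFiveTerm, sixPhiFiveTerm, sixPhiFiveAntidiff, sixPhiFiveAntidiff, sixPhiFiveKernel_succ,
    sixPhiFiveKernel_mul_base ha₀ (by simpa using hcd 0) (by simpa using hbd 0)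
      (by simpa using hbc 0), pow_succ' q n]
  have hpoly := sixPhiFive_polynomial_identity h (q ^ n)
  generalize sixPhiFiveKernel a b c d q z n = K
  generalize q ^ n = x at *
  generalize 1 - z * c * d * x = u at *
  generalize 1 - z * b * d * x = v at *
  generalize 1 - z * b * c * x = w at *
  generalize (1 - z * c * d) * (1 - z * b * d) * (1 - z * b * c) = m at *
  generalize 1 - q * x = y at *
  generalize 1 - a = d₀ at *
  generalize 1 - a * q = d₁ at *
  field_simp
  linear_combination m * K * hpoly

theorem isBigO_sixPhiFiveTerm_mul_pow_succ (hq : ‖q‖ < 1)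
    (ha : ∀ j : ℕ, 1 - a * q ^ j ≠ 0) (hcd : ∀ j : ℕ, 1 - z * c * d * q ^ j ≠ 0)
    (hbd : ∀ j : ℕ, 1 - z * b * d * q ^ j ≠ 0) (hbc : ∀ j : ℕ, 1 - z * b * c * q ^ j ≠ 0) :
    (fun p : ℕ × ℕ => sixPhiFiveTerm (a * q ^ p.1) b c d q (z * q ^ p.1) (p.2 + 1)) =O[⊤]
      fun p => q ^ p.1 * z ^ p.2 := by
  have hlin := isBigO_top_comp (isBigO_one_sub_mul_pow hq a)
    fun p : ℕ × ℕ => p.1 + 2 * (p.2 + 1)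
  have hbase := isBigO_top_comp (isBigO_inv_qPoch_mul_pow hq ha) fun p : ℕ × ℕ => (p.1, 1)
  have hnum_a := isBigO_top_comp (isBigO_qPoch_mul_pow hq ha) fun p : ℕ × ℕ => (p.1, p.2 + 1)
  have hnum (e : ℂ) := isBigO_top_comp (isBigO_qPoch hq e) fun p : ℕ × ℕ => p.2 + 1
  have hden_q := isBigO_top_comp (isBigO_inv_qPoch hq (one_sub_mul_pow_ne_zero hq hq))
    fun p : ℕ × ℕ => p.2 + 1
  have hden {e : ℂ} (he : ∀ j : ℕ, 1 - e * q ^ j ≠ 0) :=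
    isBigO_top_comp (isBigO_inv_qPoch_mul_pow hq he) fun p : ℕ × ℕ => (p.1, p.2 + 1)
  have h := ((hlin.mul hbase).mul (((hnum_a.mul (hnum b)).mul (hnum c)).mul (hnum d))).mul
    ((((hden_q.mul (hden hcd)).mul (hden hbd)).mul (hden hbc)).mul (isBigO_mul_pow_pow_succ hq z))
  refine h.congr (fun ⟨m, n⟩ => ?_) fun _ => by simp
  rw [sixPhiFiveTerm, sixPhiFiveKernel, show z * q ^ m * c * d = z * c * d * q ^ m by ring,
    show z * q ^ m * b * d = z * b * d * q ^ m by ring,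
    show z * q ^ m * b * c = z * b * c * q ^ m by ring]
  simp only [qPoch_one, pow_add, div_eq_mul_inv, mul_inv]
  ring

theorem summable_sixPhiFiveTerm (hq : ‖q‖ < 1) (hz : ‖z‖ < 1)
    (ha : ∀ j : ℕ, 1 - a * q ^ j ≠ 0) (hcd : ∀ j : ℕ, 1 - z * c * d * q ^ j ≠ 0)
    (hbd : ∀ j : ℕ, 1 - z * b * d * q ^ j ≠ 0) (hbc : ∀ j : ℕ, 1 - z * b * c * q ^ j ≠ 0) (m : ℕ) :
    Summable (sixPhiFiveTerm (a * q ^ m) b c d q (z * q ^ m)) :=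
  (summable_nat_add_iff 1).1 <| summable_of_isBigO_mul_pow
    (f := fun m n => sixPhiFiveTerm (a * q ^ m) b c d q (z * q ^ m) (n + 1)) hz
    (isBigO_sixPhiFiveTerm_mul_pow_succ hq ha hcd hbd hbc) m

theorem tendsto_tsum_sixPhiFiveTerm (hq : ‖q‖ < 1) (hz : ‖z‖ < 1)
    (ha : ∀ j : ℕ, 1 - a * q ^ j ≠ 0) (hcd : ∀ j : ℕ, 1 - z * c * d * q ^ j ≠ 0)
    (hbd : ∀ j : ℕ, 1 - z * b * d * q ^ j ≠ 0) (hbc : ∀ j : ℕ, 1 - z * b * c * q ^ j ≠ 0) :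
    Tendsto (fun m : ℕ => ∑' n, sixPhiFiveTerm (a * q ^ m) b c d q (z * q ^ m) n) atTop (𝓝 1) := by
  have htail := tendsto_tsum_of_isBigO_mul_pow
    (f := fun m n => sixPhiFiveTerm (a * q ^ m) b c d q (z * q ^ m) (n + 1)) hq hz
    (isBigO_sixPhiFiveTerm_mul_pow_succ hq ha hcd hbd hbc)
  have hhead (m : ℕ) : sixPhiFiveTerm (a * q ^ m) b c d q (z * q ^ m) 0 = 1 := by
    simp [sixPhiFiveTerm, sixPhiFiveKernel, qPoch, div_self (ha m)]
  refine (add_zero (1 : ℂ) ▸ htail.const_add 1).congr fun m => ?_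
  rw [(summable_sixPhiFiveTerm hq hz ha hcd hbd hbc m).tsum_eq_zero_add, hhead]

theorem tendsto_sixPhiFiveAntidiff (hq : ‖q‖ < 1) (hz : ‖z‖ < 1) (a b c d : ℂ)
    (hcd : ∀ j : ℕ, 1 - z * c * d * q ^ j ≠ 0) (hbd : ∀ j : ℕ, 1 - z * b * d * q ^ j ≠ 0)
    (hbc : ∀ j : ℕ, 1 - z * b * c * q ^ j ≠ 0) :
    Tendsto (sixPhiFiveAntidiff a b c d q z) atTop (𝓝 0) := by
  have hpow := tendsto_pow_atTop_nhds_zero_of_norm_lt_one hq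
  have hnum := ((((tendsto_qPoch hq a).mul (tendsto_qPoch hq b)).mul (tendsto_qPoch hq c)).mul
    (tendsto_qPoch hq d)).mul (tendsto_pow_atTop_nhds_zero_of_norm_lt_one hz)
  have hden := (((tendsto_qPoch hq q).mul (tendsto_qPoch hq (z * c * d))).mul
    (tendsto_qPoch hq (z * b * d))).mul (tendsto_qPoch hq (z * b * c))
  have hne := mul_ne_zero (mul_ne_zero (mul_ne_zero
    (qPochInf_ne_zero hq (one_sub_mul_pow_ne_zero hq hq)) (qPochInf_ne_zero hq hcd))
    (qPochInf_ne_zero hq hbd)) (qPochInf_ne_zero hq hbc)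
  simpa using! (((hpow.const_sub 1).mul ((hpow.const_mul (a * z)).const_sub 1)).const_mul
    ((1 - z * c * d) * (1 - z * b * d) * (1 - z * b * c) / (1 - a))).mul (hnum.div hden hne)

theorem tsum_sixPhiFiveTerm_contiguous (hq : ‖q‖ < 1) (hz : ‖z‖ < 1) (h : a * q = z * b * c * d)
    (ha : ∀ j : ℕ, 1 - a * q ^ j ≠ 0) (hcd : ∀ j : ℕ, 1 - z * c * d * q ^ j ≠ 0)
    (hbd : ∀ j : ℕ, 1 - z * b * d * q ^ j ≠ 0) (hbc : ∀ j : ℕ, 1 - z * b * c * q ^ j ≠ 0) :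
    (1 - z) * ((1 - z * c * d) * (1 - z * b * d) * (1 - z * b * c)) *
        ∑' n, sixPhiFiveTerm a b c d q z n =
      (1 - a * q) * (1 - z * b) * (1 - z * c) * (1 - z * d) *
        ∑' n, sixPhiFiveTerm (a * q) b c d q (z * q) n := by
  have hsum := summable_sixPhiFiveTerm hq hz ha hcd hbd hbc
  have h₀ := (hsum 0).hasSum
  have h₁ := (hsum 1).hasSum
  simp only [pow_zero, pow_one, mul_one] at h₀ h₁
  have htele := eq_sub_of_hasSum_sub_succ ((h₀.mul_left _).sub (h₁.mul_left _))
    (tendsto_sixPhiFiveAntidiff hq hz a b c d hcd hbd hbc)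
    (sixPhiFiveTerm_contiguous hq h ha hcd hbd hbc)
  exact sub_eq_zero.1 (htele.trans (by simp [sixPhiFiveAntidiff]))

theorem qPoch_mul_tsum_sixPhiFiveTerm (hq : ‖q‖ < 1) (hz : ‖z‖ < 1) (h : a * q = z * b * c * d)
    (ha : ∀ j : ℕ, 1 - a * q ^ j ≠ 0) (hcd : ∀ j : ℕ, 1 - z * c * d * q ^ j ≠ 0)
    (hbd : ∀ j : ℕ, 1 - z * b * d * q ^ j ≠ 0) (hbc : ∀ j : ℕ, 1 - z * b * c * q ^ j ≠ 0) (m : ℕ) :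
    qPoch z q m * (qPoch (z * c * d) q m * qPoch (z * b * d) q m * qPoch (z * b * c) q m) *
        ∑' n, sixPhiFiveTerm a b c d q z n =
      qPoch (a * q) q m * qPoch (z * b) q m * qPoch (z * c) q m * qPoch (z * d) q m *
        ∑' n, sixPhiFiveTerm (a * q ^ m) b c d q (z * q ^ m) n := by
  induction m with
  | zero => simp [qPoch]
  | succ m ih =>
    have hshift {e : ℂ} (he : ∀ j : ℕ, 1 - e * q ^ j ≠ 0) (j : ℕ) :
        1 - e * q ^ m * q ^ j ≠ 0 := by
      simpa only [mul_assoc, ← pow_add] using he (m + j)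
    have hstep := tsum_sixPhiFiveTerm_contiguous (a := a * q ^ m) (z := z * q ^ m) (b := b) (c := c)
      (d := d) hq (norm_mul_pow_lt_one hq hz m) (by linear_combination q ^ m * h) (hshift ha)
      (fun j => by convert hshift hcd j using 1; ring)
      (fun j => by convert hshift hbd j using 1; ring)
      (fun j => by convert hshift hbc j using 1; ring)
    rw [mul_assoc a (q ^ m) q, mul_assoc z (q ^ m) q, ← pow_succ] at hstep
    simp only [qPoch_succ]
    linear_combination (1 - z * q ^ m) * (1 - z * c * d * q ^ m) * (1 - z * b * d * q ^ m) *
      (1 - z * b * c * q ^ m) * ih +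
      qPoch (a * q) q m * qPoch (z * b) q m * qPoch (z * c) q m * qPoch (z * d) q m * hstep

theorem hasSum_sixPhiFiveTerm (hq : ‖q‖ < 1) (hz : ‖z‖ < 1) (h : a * q = z * b * c * d)
    (ha : ∀ j : ℕ, 1 - a * q ^ j ≠ 0) (hcd : ∀ j : ℕ, 1 - z * c * d * q ^ j ≠ 0)
    (hbd : ∀ j : ℕ, 1 - z * b * d * q ^ j ≠ 0) (hbc : ∀ j : ℕ, 1 - z * b * c * q ^ j ≠ 0) :
    HasSum (sixPhiFiveTerm a b c d q z)
      (qPochInf (a * q) q * qPochInf (z * b) q * qPochInf (z * c) q * qPochInf (z * d) q /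
        (qPochInf z q *
          (qPochInf (z * c * d) q * qPochInf (z * b * d) q * qPochInf (z * b * c) q))) := by
  have hsum : Summable (sixPhiFiveTerm a b c d q z) := by
    simpa using summable_sixPhiFiveTerm hq hz ha hcd hbd hbc 0
  have hlim := fun e => tendsto_qPoch hq e
  have hleft := ((hlim z).mul (((hlim (z * c * d)).mul (hlim (z * b * d))).mul
    (hlim (z * b * c)))).mul_const (∑' n, sixPhiFiveTerm a b c d q z n)
  have hright := ((((hlim (a * q)).mul (hlim (z * b))).mul (hlim (z * c))).mul
    (hlim (z * d))).mul (tendsto_tsum_sixPhiFiveTerm hq hz ha hcd hbd hbc)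
  have heq := tendsto_nhds_unique hleft
    (hright.congr fun m => (qPoch_mul_tsum_sixPhiFiveTerm hq hz h ha hcd hbd hbc m).symm)
  have hne := mul_ne_zero (qPochInf_ne_zero hq (one_sub_mul_pow_ne_zero hq hz)) (mul_ne_zero
    (mul_ne_zero (qPochInf_ne_zero hq hcd) (qPochInf_ne_zero hq hbd)) (qPochInf_ne_zero hq hbc))
  rw [mul_one, mul_comm] at heq
  rw [← (eq_div_iff hne).2 heq]
  exact hsum.hasSum

end SixPhiFive

section LambertProduct

variable {p x y q : ℂ}

theorem sixPhiFiveTerm_of_mul_eq_sq (hp : ‖p‖ < 1) (hx : ‖x‖ < 1) (hy : ‖y‖ < 1)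
    (hpq : p ^ 2 = q) (hxy : x * y = q) (n : ℕ) :
    sixPhiFiveTerm q p x y q p n = (1 - p) * (1 - x) * (1 - y) / (1 - q) *
      (p ^ n * (1 + p * q ^ n) / ((1 - x * q ^ n) * (1 - y * q ^ n))) := by
  have hq : ‖q‖ < 1 := hpq ▸ norm_pow_lt_one hp two_ne_zero
  have hone {e : ℂ} (he : ‖e‖ < 1) := one_sub_ne_zero_of_norm_lt_one he
  have hpoch {e : ℂ} (he : ‖e‖ < 1) := qPoch_ne_zero (one_sub_mul_pow_ne_zero hq he) n
  have hsq : 1 - q * (q ^ n) ^ 2 = (1 - p * q ^ n) * (1 + p * q ^ n) := by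
    linear_combination (q ^ n) ^ 2 * hpq
  rw [sixPhiFiveTerm, sixPhiFiveKernel, show p * x * y = p * q by rw [mul_assoc, hxy],
    show p * p * y = y * q by rw [← hpq]; ring, show p * p * x = x * q by rw [← hpq]; ring,
    qPoch_mul_base (hone hp), qPoch_mul_base (hone hx), qPoch_mul_base (hone hy), hsq]
  have hp₀ := hone hp
  have hx₀ := hone hx
  have hy₀ := hone hy
  have hq₀ := hone hq
  have hpn := one_sub_mul_pow_ne_zero hq hp n
  have hqp := hpoch hp
  have hqx := hpoch hx
  have hqy := hpoch hy
  have hqq := hpoch hq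
  field_simp

theorem hasSum_bilateral_lambert (hp : ‖p‖ < 1) (hx : ‖x‖ < 1) (hy : ‖y‖ < 1)
    (hpq : p ^ 2 = q) (hxy : x * y = q) :
    HasSum (fun n : ℕ => p ^ n * (1 + p * q ^ n) / ((1 - x * q ^ n) * (1 - y * q ^ n)))
      (qPochInf q q ^ 2 * qPochInf (p * x) q * qPochInf (p * y) q /
        (qPochInf p q ^ 2 * qPochInf x q * qPochInf y q)) := by
  have hq : ‖q‖ < 1 := hpq ▸ norm_pow_lt_one hp two_ne_zero
  have hone {e : ℂ} (he : ‖e‖ < 1) := one_sub_ne_zero_of_norm_lt_one he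
  have hshift {e : ℂ} (he : ‖e‖ < 1) : ∀ n : ℕ, 1 - e * q * q ^ n ≠ 0 :=
    one_sub_mul_pow_ne_zero hq (by simpa using norm_mul_pow_lt_one hq he 1)
  have hpxy : p * x * y = p * q := by rw [mul_assoc, hxy]
  have hppy : p * p * y = y * q := by rw [← hpq]; ring
  have hppx : p * p * x = x * q := by rw [← hpq]; ring
  have hsum := (hasSum_sixPhiFiveTerm hq hp (a := q) (b := p) (c := x) (d := y)
    (by linear_combination -p ^ 2 * hxy - q * hpq) (one_sub_mul_pow_ne_zero hq hq)
    (hpxy ▸ hshift hp) (hppy ▸ hshift hy) (hppx ▸ hshift hx)).mul_left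
    ((1 - q) / ((1 - p) * (1 - x) * (1 - y)))
  have hp₀ := hone hp
  have hx₀ := hone hx
  have hy₀ := hone hy
  have hq₀ := hone hq
  convert! hsum using 1
  · funext n
    rw [sixPhiFiveTerm_of_mul_eq_sq hp hx hy hpq hxy]
    generalize (1 - x * q ^ n) * (1 - y * q ^ n) = d
    field_simp
  · rw [hpxy, hppy, hppx, ← pow_two p, hpq, qPochInf_mul_base hq hq₀, qPochInf_mul_base hq hp₀,
      qPochInf_mul_base hq hx₀, qPochInf_mul_base hq hy₀]
    field_simp

end LambertProduct

section Psi

variable {q : ℂ}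

/-- The quotient `(q²; q²)_n / (q; q²)_n`, whose limit is Gauss's product for `ψ(q)`. -/
noncomputable def psiPartialProd (q : ℂ) (n : ℕ) : ℂ :=
  qPoch (q ^ 2) (q ^ 2) n / qPoch q (q ^ 2) n

/-- The summand of a finite form of Gauss's product formula for `ψ`: the sum over `s ≤ n` is the
sum of the first `2n + 1` terms of `ψ(q)`. -/
noncomputable def psiTerm (q : ℂ) (n s : ℕ) : ℂ :=
  psiPartialProd q n / psiPartialProd q s * q ^ (s * (2 * n + 1))

theorem psiPartialProd_succ (q : ℂ) (n : ℕ) :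
    psiPartialProd q (n + 1) =
      psiPartialProd q n * ((1 - q * q ^ (2 * n + 1)) / (1 - q ^ (2 * n + 1))) := by
  simp only [psiPartialProd, qPoch_succ, mul_div_mul_comm]
  ring_nf

theorem psiPartialProd_ne_zero (hq : ‖q‖ < 1) (n : ℕ) : psiPartialProd q n ≠ 0 :=
  have hq₂ := norm_pow_lt_one hq two_ne_zero
  div_ne_zero (qPoch_ne_zero (one_sub_mul_pow_ne_zero hq₂ hq₂) n)
    (qPoch_ne_zero (one_sub_mul_pow_ne_zero hq₂ hq) n)

theorem psiTerm_self (hq : ‖q‖ < 1) (n : ℕ) : psiTerm q n n = q ^ (n * (2 * n + 1)) := by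
  rw [psiTerm, div_self (psiPartialProd_ne_zero hq n), one_mul]

theorem psiTerm_succ_left (q : ℂ) (n s : ℕ) :
    psiTerm q (n + 1) s =
      psiTerm q n s * ((1 - q * q ^ (2 * n + 1)) / (1 - q ^ (2 * n + 1)) * q ^ (2 * s)) := by
  rw [psiTerm, psiTerm, psiPartialProd_succ]
  ring

theorem psiTerm_succ_right (q : ℂ) (n s : ℕ) :
    psiTerm q n (s + 1) =
      psiTerm q n s * ((1 - q ^ (2 * s + 1)) / (1 - q * q ^ (2 * s + 1)) * q ^ (2 * n + 1)) := by
  rw [psiTerm, psiTerm, psiPartialProd_succ, ← div_div, div_div_eq_mul_div]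
  ring

theorem sum_range_psiTerm_succ (hq : ‖q‖ < 1) (n k : ℕ) :
    ∑ s ∈ Finset.range k, psiTerm q (n + 1) s =
      ∑ s ∈ Finset.range k, psiTerm q n s +
        (1 - q ^ (2 * k)) / (1 - q ^ (2 * n + 1)) * psiTerm q n k := by
  have hodd : 1 - q ^ (2 * n + 1) ≠ 0 := by
    simpa only [pow_succ'] using one_sub_mul_pow_ne_zero hq hq (2 * n)
  have htele := Finset.sum_range_sub
    (fun s => (1 - q ^ (2 * s)) / (1 - q ^ (2 * n + 1)) * psiTerm q n s) k
  simp only [mul_zero, pow_zero, sub_self, zero_div, zero_mul, sub_zero] at htele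
  rw [← htele, ← Finset.sum_add_distrib]
  refine Finset.sum_congr rfl fun s _ => ?_
  have heven := one_sub_mul_pow_ne_zero hq hq (2 * s + 1)
  rw [psiTerm_succ_left, psiTerm_succ_right]
  have hden : 1 - q ^ (2 * (s + 1)) = 1 - q * q ^ (2 * s + 1) := by ring
  rw [hden]
  field_simp
  ring

theorem sum_range_two_mul_add_one_pow_triangular (hq : ‖q‖ < 1) (n : ℕ) :
    ∑ s ∈ Finset.range (2 * n + 1), q ^ (s * (s + 1) / 2) =
      ∑ s ∈ Finset.range (n + 1), psiTerm q n s := by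
  induction n with
  | zero => simp [psiTerm_self hq]
  | succ n ih =>
    have hodd : 1 - q ^ (2 * n + 1) ≠ 0 := by
      simpa only [pow_succ'] using one_sub_mul_pow_ne_zero hq hq (2 * n)
    have heven := one_sub_mul_pow_ne_zero hq hq (2 * n + 1)
    have hexp₁ : (2 * n + 1) * (2 * n + 1 + 1) / 2 = n * (2 * n + 1) + (2 * n + 1) :=
      Nat.div_eq_of_eq_mul_left two_pos (by ring)
    have hexp₂ : (2 * n + 2) * (2 * n + 2 + 1) / 2 = (n + 1) * (2 * (n + 1) + 1) :=
      Nat.div_eq_of_eq_mul_left two_pos (by ring)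
    rw [Nat.mul_succ, Finset.sum_range_succ, Finset.sum_range_succ, Finset.sum_range_succ _ (n + 1),
      sum_range_psiTerm_succ hq, psiTerm_succ_right, psiTerm_self hq, psiTerm_self hq, ih,
      hexp₁, hexp₂, show 1 - q ^ (2 * (n + 1)) = 1 - q * q ^ (2 * n + 1) by ring]
    field_simp
    ring

theorem isBigO_psiTerm_succ (hq : ‖q‖ < 1) :
    (fun p : ℕ × ℕ => psiTerm q p.1 (p.2 + 1)) =O[⊤] fun p => q ^ p.1 * q ^ p.2 := by
  have hq₂ := norm_pow_lt_one hq two_ne_zero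
  have hnum := isBigO_top_comp (β := ℕ × ℕ) (isBigO_qPoch hq₂ (q ^ 2))
  have hnum_inv := isBigO_top_comp (β := ℕ × ℕ)
    (isBigO_inv_qPoch hq₂ (one_sub_mul_pow_ne_zero hq₂ hq₂))
  have hden := isBigO_top_comp (β := ℕ × ℕ) (isBigO_qPoch hq₂ q)
  have hden_inv := isBigO_top_comp (β := ℕ × ℕ)
    (isBigO_inv_qPoch hq₂ (one_sub_mul_pow_ne_zero hq₂ hq))
  have hpow : (fun p : ℕ × ℕ => q ^ ((p.2 + 1) * (2 * p.1 + 1))) =O[⊤]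
      fun p => q ^ p.1 * q ^ p.2 := by
    refine isBigO_of_le _ fun ⟨m, n⟩ => ?_
    rw [← pow_add, norm_pow, norm_pow]
    exact pow_le_pow_of_le_one (norm_nonneg q) hq.le (by dsimp only; nlinarith)
  have h := ((hnum Prod.fst).mul (hden_inv Prod.fst)).mul
    (((hnum_inv fun p : ℕ × ℕ => p.2 + 1).mul (hden fun p => p.2 + 1)).mul hpow)
  refine h.congr (fun ⟨m, n⟩ => ?_) fun _ => by simp
  simp only [psiTerm, psiPartialProd, div_eq_mul_inv, mul_inv, inv_inv]
  ring

theorem tendsto_sum_range_psiTerm (hq : ‖q‖ < 1) :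
    Tendsto (fun n => ∑ s ∈ Finset.range (n + 1), psiTerm q n s) atTop
      (𝓝 (qPochInf (q ^ 2) (q ^ 2) / qPochInf q (q ^ 2))) := by
  have hq₂ := norm_pow_lt_one hq two_ne_zero
  have hhead : Tendsto (psiPartialProd q) atTop
      (𝓝 (qPochInf (q ^ 2) (q ^ 2) / qPochInf q (q ^ 2))) :=
    (tendsto_qPoch hq₂ _).div (tendsto_qPoch hq₂ _)
      (qPochInf_ne_zero hq₂ (one_sub_mul_pow_ne_zero hq₂ hq))
  have hbound : (fun p : ℕ × ℕ => if p.2 < p.1 then psiTerm q p.1 (p.2 + 1) else 0) =O[⊤]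
      fun p => q ^ p.1 * q ^ p.2 :=
    (isBigO_of_le ⊤ fun p => by split_ifs <;> simp).trans (isBigO_psiTerm_succ hq)
  have htail := tendsto_tsum_of_isBigO_mul_pow
    (f := fun m n => if n < m then psiTerm q m (n + 1) else 0) hq hq hbound
  refine (zero_add (_ : ℂ) ▸ htail.add hhead).congr fun n => ?_
  rw [Finset.sum_range_succ',
    tsum_eq_sum (s := Finset.range n) fun s hs => if_neg (by simpa using hs)]
  refine congrArg₂ _ (Finset.sum_congr rfl fun s hs => if_pos (Finset.mem_range.1 hs)) ?_
  simp [psiTerm, psiPartialProd, qPoch]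

theorem summable_pow_triangular (hq : ‖q‖ < 1) : Summable fun n : ℕ => q ^ (n * (n + 1) / 2) := by
  refine Summable.of_norm_bounded (summable_norm_geometric_of_norm_lt_one hq) fun n => ?_
  rw [norm_pow, norm_pow]
  refine pow_le_pow_of_le_one (norm_nonneg q) hq.le ?_
  rw [Nat.le_div_iff_mul_le two_pos]
  rcases n with _ | n <;> nlinarith

theorem ramanujanPsi_eq_qPochInf_div (hq : ‖q‖ < 1) :
    ramanujanPsi q = qPochInf (q ^ 2) (q ^ 2) / qPochInf q (q ^ 2) := by
  have hodd : Tendsto (fun n : ℕ => 2 * n + 1) atTop atTop :=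
    tendsto_atTop_mono (fun n : ℕ => (by lia : n ≤ 2 * n + 1)) tendsto_id
  refine tendsto_nhds_unique
    ((summable_pow_triangular hq).hasSum.tendsto_sum_nat.comp hodd)
    ((tendsto_sum_range_psiTerm hq).congr fun n => ?_)
  exact (sum_range_two_mul_add_one_pow_triangular hq n).symm

end Psi

section PsiProduct

variable {q : ℂ}

theorem hasSum_ramanujanPsi_mul_ramanujanPsi_cube (hq : ‖q‖ < 1) :
    HasSum (fun n : ℕ => q ^ (3 * n) / (1 - q ^ (6 * n + 1)) -
      q ^ (3 * n + 2) / (1 - q ^ (6 * n + 5))) (ramanujanPsi q * ramanujanPsi (q ^ 3)) := by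
  have hq₂ := norm_pow_lt_one hq two_ne_zero
  have hq₆ : ‖q ^ 6‖ < 1 := norm_pow_lt_one hq (by norm_num)
  have hq₃ := norm_pow_lt_one hq three_ne_zero
  have hne₂ := one_sub_ne_zero_of_norm_lt_one hq₂
  have hsum := (hasSum_bilateral_lambert (p := q ^ 3) (x := q) (y := q ^ 5) (q := q ^ 6)
    hq₃ hq (norm_pow_lt_one hq (by norm_num)) (by ring)
    (by ring)).mul_left (1 - q ^ 2)
  convert! hsum using 1
  · funext n
    have h₁ := one_sub_mul_pow_ne_zero hq₆ hq n
    have h₅ := one_sub_mul_pow_ne_zero hq₆ (norm_pow_lt_one hq (by norm_num : 5 ≠ 0)) n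
    rw [show q ^ (6 * n + 1) = q * (q ^ 6) ^ n by ring,
      show q ^ (6 * n + 5) = q ^ 5 * (q ^ 6) ^ n by ring, div_sub_div _ _ h₁ h₅, mul_div_assoc']
    ring
  · have hnum : qPochInf (q ^ 2) (q ^ 2) =
        qPochInf (q ^ 2) (q ^ 6) * qPochInf (q ^ 4) (q ^ 6) * qPochInf (q ^ 6) (q ^ 6) := by
      simp [qPochInf_eq_prod hq₂ (q ^ 2) three_ne_zero, Finset.prod_range_succ, ← pow_mul,
        ← pow_add]
    have hden : qPochInf q (q ^ 2) =
        qPochInf q (q ^ 6) * qPochInf (q ^ 3) (q ^ 6) * qPochInf (q ^ 5) (q ^ 6) := by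
      simp [qPochInf_eq_prod hq₂ q three_ne_zero, Finset.prod_range_succ, ← pow_mul, ← pow_succ']
    rw [ramanujanPsi_eq_qPochInf_div hq, ramanujanPsi_eq_qPochInf_div hq₃,
      ← pow_mul, hnum, hden, show q ^ 3 * q = q ^ 4 by ring,
      show q ^ 3 * q ^ 5 = q ^ 2 * q ^ 6 by ring, qPochInf_mul_base hq₆ hne₂]
    field_simp

theorem two_mul_ramanujanPsi_mul_ramanujanPsi_eq_lambertSum (hq0 : q ≠ 0) (hq : ‖q‖ < 1) :
    2 * q * ramanujanPsi (q ^ 2) * ramanujanPsi (q ^ 6) =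
      (lambertSum (1 / q ^ 5) (q ^ 6) - lambertSum (-1 / q ^ 5) (q ^ 6)) -
        (lambertSum (1 / q) (q ^ 6) - lambertSum (-1 / q) (q ^ 6)) := by
  have hq₆ : ‖q ^ 6‖ < 1 := norm_pow_lt_one hq (by norm_num)
  have hψ := (hasSum_ramanujanPsi_mul_ramanujanPsi_cube
    (norm_pow_lt_one hq two_ne_zero)).mul_left (2 * q)
  simp only [← pow_mul, Nat.reduceMul] at hψ
  have hmul₅ : 1 / q ^ 5 * q ^ 6 = q := by field_simp
  have hmul₁ : 1 / q * q ^ 6 = q ^ 5 := by field_simp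
  have h₅ := hasSum_lambertSum_sub_neg (a := 1 / q ^ 5) hq₆ (by rwa [hmul₅])
  have h₁ := hasSum_lambertSum_sub_neg (a := 1 / q) hq₆
    (by simpa only [hmul₁] using norm_pow_lt_one hq (by norm_num : 5 ≠ 0))
  simp only [pow_succ' (q ^ 6), ← mul_assoc, hmul₅, hmul₁, ← neg_div] at h₁ h₅
  rw [mul_assoc]
  refine hψ.unique ((h₅.sub h₁).congr_fun fun n => ?_)
  ring_nf

end PsiProduct

section PowerBase

variable {q ε : ℂ} {k m : ℕ}

theorem hasSum_pnat_of_succ {M : Type*} [AddCommMonoid M] [TopologicalSpace M] {f : ℕ → M} {S : M}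
    (h : HasSum (fun n => f (n + 1)) S) : HasSum (fun n : ℕ+ => f n) S := by
  simpa [Function.comp_def] using (Equiv.pnatEquivNat.hasSum_iff (f := fun n => f (n + 1))).2 h

theorem div_pow_mul_pow (hq0 : q ≠ 0) (hkm : k ≤ m) (ε : ℂ) :
    ε / q ^ k * q ^ m = ε * q ^ (m - k) := by
  rw [pow_sub₀ q hq0 hkm]
  ring

theorem hasSum_vwpTerm_div_pow (hq0 : q ≠ 0) (hq : ‖q‖ < 1) (hε : ε ^ 2 = 1) (hk : k ≠ 0)
    (hkm : k < m) (hkm₂ : 2 * k ≠ m) :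
    HasSum (fun n : ℕ+ => vwpTerm (ε / q ^ k) (q ^ m) n)
      (lambertSum (ε / q ^ k) (q ^ m) - lambertSum ((1 / q ^ k) ^ 2) (q ^ m)) := by
  have hpos := norm_pos_iff.2 hq0
  have hε₁ : ‖ε‖ = 1 := Complex.norm_eq_one_of_pow_eq_one hε two_ne_zero
  have hsq : (1 / q ^ k) ^ 2 = (ε / q ^ k) ^ 2 := by rw [div_pow, div_pow, hε, one_pow]
  rw [hsq]
  refine hasSum_pnat_of_succ (f := vwpTerm (ε / q ^ k) (q ^ m)) (hasSum_vwpTerm ?_ ?_ ?_ ?_)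
  · exact norm_pow_lt_one hq (Nat.ne_zero_of_lt hkm)
  · rw [div_pow_mul_pow hq0 hkm.le, norm_mul, hε₁, one_mul]
    exact norm_pow_lt_one hq (Nat.sub_ne_zero_of_lt hkm)
  · rw [Ne, div_eq_one_iff_eq (pow_ne_zero k hq0)]
    intro h
    have hlt := norm_pow_lt_one hq hk
    rw [← h, hε₁] at hlt
    exact lt_irrefl _ hlt
  · rw [div_pow, hε, one_div_mul_eq_div, Ne, div_eq_one_iff_eq (by positivity), ← pow_mul]
    intro h
    have hnorm : ‖q‖ ^ m = ‖q‖ ^ (k * 2) := by simpa using congrArg norm h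
    have hexp := pow_right_injective₀ hpos hq.ne hnorm
    lia

theorem vwpTerm_div_pow (hq0 : q ≠ 0) (hε : ε ^ 2 = 1) (hkm : k ≤ m) (n : ℕ+) :
    vwpTerm (ε / q ^ k) (q ^ m) n =
      (1 - ε * q ^ (2 * m * (n : ℕ) - k)) / (1 - ε / q ^ k) *
        (qPoch (ε / q ^ k) (q ^ m) n * qPoch (ε / q ^ k) (q ^ m) n *
            qPoch (q ^ m) (q ^ m) (2 * (n : ℕ) - 1) * (ε * q ^ (m - k)) ^ (n : ℕ) /
          (qPoch (q ^ m) (q ^ m) n * qPoch (q ^ m) (q ^ m) n *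
            qPoch (q ^ m / (q ^ k) ^ 2) (q ^ m) (2 * (n : ℕ)))) := by
  have hlin : ε / q ^ k * (q ^ m) ^ (2 * (n : ℕ)) = ε * q ^ (2 * m * (n : ℕ) - k) := by
    have hexp : k ≤ 2 * m * (n : ℕ) := by nlinarith [n.pos]
    rw [← div_pow_mul_pow hq0 hexp]
    ring
  have hden : (ε / q ^ k) ^ 2 * q ^ m = q ^ m / (q ^ k) ^ 2 := by
    rw [div_pow, hε]
    ring
  rw [vwpTerm, hlin, div_pow_mul_pow hq0 hkm, hden]

end PowerBase

theorem corollary6 (q : ℂ) (hq0 : q ≠ 0) (hq1 : ‖q‖ < 1) :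
    ∃ S₁ S₂ S₃ S₄ : ℂ,
      HasSum (fun n : ℕ+ =>
        (1 + q ^ (12 * (n : ℕ) - 1)) / (1 + 1 / q) *
          (qPoch (-1 / q) (q ^ 6) n * qPoch (-1 / q) (q ^ 6) n *
              qPoch (q ^ 6) (q ^ 6) (2 * (n : ℕ) - 1) * (-q) ^ (5 * (n : ℕ)) /
            (qPoch (q ^ 6) (q ^ 6) n * qPoch (q ^ 6) (q ^ 6) n *
              qPoch (q ^ 4) (q ^ 6) (2 * (n : ℕ))))) S₁ ∧
      HasSum (fun n : ℕ+ =>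
        (1 - q ^ (12 * (n : ℕ) - 1)) / (1 - 1 / q) *
          (qPoch (1 / q) (q ^ 6) n * qPoch (1 / q) (q ^ 6) n *
              qPoch (q ^ 6) (q ^ 6) (2 * (n : ℕ) - 1) * q ^ (5 * (n : ℕ)) /
            (qPoch (q ^ 6) (q ^ 6) n * qPoch (q ^ 6) (q ^ 6) n *
              qPoch (q ^ 4) (q ^ 6) (2 * (n : ℕ))))) S₂ ∧
      HasSum (fun n : ℕ+ =>
        (1 - q ^ (12 * (n : ℕ) - 5)) / (1 - 1 / q ^ 5) *
          (qPoch (1 / q ^ 5) (q ^ 6) n * qPoch (1 / q ^ 5) (q ^ 6) n *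
              qPoch (q ^ 6) (q ^ 6) (2 * (n : ℕ) - 1) * q ^ (n : ℕ) /
            (qPoch (q ^ 6) (q ^ 6) n * qPoch (q ^ 6) (q ^ 6) n *
              qPoch (1 / q ^ 4) (q ^ 6) (2 * (n : ℕ))))) S₃ ∧
      HasSum (fun n : ℕ+ =>
        (1 + q ^ (12 * (n : ℕ) - 5)) / (1 + 1 / q ^ 5) *
          (qPoch (-1 / q ^ 5) (q ^ 6) n * qPoch (-1 / q ^ 5) (q ^ 6) n *
              qPoch (q ^ 6) (q ^ 6) (2 * (n : ℕ) - 1) * (-q) ^ (n : ℕ) /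
            (qPoch (q ^ 6) (q ^ 6) n * qPoch (q ^ 6) (q ^ 6) n *
              qPoch (1 / q ^ 4) (q ^ 6) (2 * (n : ℕ))))) S₄ ∧
      2 * q * ramanujanPsi (q ^ 2) * ramanujanPsi (q ^ 6) = S₁ - S₂ + S₃ - S₄ := by
  have hsum (k : ℕ) (ε : ℂ) (hε : ε ^ 2 = 1) (hk : k ≠ 0) (hk₆ : k < 6) (hk₃ : 2 * k ≠ 6) :=
    (hasSum_vwpTerm_div_pow hq0 hq1 hε hk hk₆ hk₃).congr_fun
      fun n => (vwpTerm_div_pow hq0 hε hk₆.le n).symm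
  have hq₄ : q ^ 6 / q ^ 2 = q ^ 4 := by field_simp
  have hq₄' : q ^ 6 / (q ^ 5) ^ 2 = 1 / q ^ 4 := by field_simp
  have hodd (n : ℕ) : (-q) ^ (5 * n) = (-q ^ 5) ^ n := by
    rw [pow_mul, Odd.neg_pow (by decide : Odd 5)]
  have h₁ := hsum 1 (-1) (by norm_num) (by norm_num) (by norm_num) (by norm_num)
  have h₂ := hsum 1 1 (by norm_num) (by norm_num) (by norm_num) (by norm_num)
  have h₃ := hsum 5 1 (by norm_num) (by norm_num) (by norm_num) (by norm_num)
  have h₄ := hsum 5 (-1) (by norm_num) (by norm_num) (by norm_num) (by norm_num)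
  refine ⟨_, _, _, _, h₁.congr_fun fun n => ?_, h₂.congr_fun fun n => ?_,
    h₃.congr_fun fun n => ?_, h₄.congr_fun fun n => ?_, ?_⟩
  · simp [hq₄, hodd, neg_div]
  · simp [hq₄, pow_mul]
  · simp [hq₄']
  · simp [hq₄', neg_div]
  · rw [two_mul_ramanujanPsi_mul_ramanujanPsi_eq_lambertSum hq0 hq1, pow_one]
    ring
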